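/- Fix $\delta\in(0,1)$ and $\lambda>0$. For $\boldsymbol\mu\in\mathbb R^p$, a labeled sample is a pair $(\boldsymbol x,y)$ with $y\sim\mathrm{Unif}\{\pm1\}$ and $\boldsymbol x\mid y\sim\mathcal N(y\boldsymbol\mu,\mathbf I_p)$, and an unlabeled sample is the component $\boldsymbol x$ of such a pair. Consider a sequence of tuples $(L_0,n_0,p,k)$, with $p,k$ integers and $L_0,n_0$ real, all four tending to infinity, such that $k/p\to0$ and, for all sufficiently large indices of the sequence, $$L_0<\frac{2(1-\delta)k}{\lambda}\log(p-k+1),\qquad n_0<\frac{2(1-\delta)k}{\lambda^2}\log(p-k+1)\,\max\{1,\lambda\}.$$ Let $q\in[0,1]$ (possibly depending on the tuple), $L=\lfloor qL_0\rfloor$ and $n=\lfloor(1-q)n_0\rfloor$ (read as $0$ if negative). Let $\mathbb S$ be the set of all subsets $S\subset\{1,\dots,p\}$ with $|S|=k$. Let $\varepsilon\in\{\pm1\}^p$ be any vector of signs (for instance, all equal to $+1$; it may depend on the tuple), and for $S\in\mathbb S$ let $\boldsymbol\mu^S$ be the vector with $\mu^S_j=\varepsilon_j\sqrt{\lambda/k}$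 for $j\in S$ and $\mu^S_j=0$ otherwise. Write $\mathbb P_S$ for the joint law of $L$ labeled and $n$ unlabeled samples, all independent, generated with $\boldsymbol\mu=\boldsymbol\mu^S$. Then, for any sequence of estimators $\hat S$, where $\hat S$ is a measurable function of the $L$ labeled and the $n$ unlabeled samples with values in the subsets of $\{1,\dots,p\}$, $$\max_{S\in\mathbb S}\mathbb P_S\big(\hat S\neq S\big)\ \ge\ \delta$$ for all sufficiently large indices of the sequence. (In particular, the same lower bound holds for the maximum of $\mathbb P_{\boldsymbol\mu}(\hat S\ne\mathrm{supp}\,\boldsymbol\mu)$ over all $k$-sparse $\boldsymbol\mu$ with nonzero entries in $\{\pm\sqrt{\lambda/k}\}$.) -/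

import Mathlib

open MeasureTheory ProbabilityTheory Filter Topology
open scoped ENNReal

namespace SparseMixture

/-- The Gaussian law `N(μ, I_p)` on `ℝ^p`: independent coordinates with means `μ j` and
variance one. -/
noncomputable def gaussianVec {p : ℕ} (μ : Fin p → ℝ) : Measure (Fin p → ℝ) :=
  Measure.pi fun j => gaussianReal (μ j) 1

/-- The law of one labeled sample `(x, y)`: `y` is uniform on `{1, -1}` and, given `y`,
`x` has law `N(y μ, I_p)`. -/
noncomputable def labeledLaw {p : ℕ} (μ : Fin p → ℝ) : Measure ((Fin p → ℝ) × ℝ) :=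
  (2⁻¹ : ℝ≥0∞) • (gaussianVec μ).prod (Measure.dirac 1) +
    (2⁻¹ : ℝ≥0∞) • (gaussianVec (-μ)).prod (Measure.dirac (-1))

/-- The law of one unlabeled sample `x`: the marginal of the law of `(x, y)`. -/
noncomputable def unlabeledLaw {p : ℕ} (μ : Fin p → ℝ) : Measure (Fin p → ℝ) :=
  (labeledLaw μ).map Prod.fst

/-- The data: `L` labeled and `n` unlabeled samples. -/
abbrev Data (p L n : ℕ) : Type :=
  (Fin L → (Fin p → ℝ) × ℝ) × (Fin n → Fin p → ℝ)

/-- The joint law of `L` labeled and `n` unlabeled samples, all independent. -/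
noncomputable def dataLaw {p : ℕ} (μ : Fin p → ℝ) (L n : ℕ) : Measure (Data p L n) :=
  (Measure.pi fun _ : Fin L => labeledLaw μ).prod (Measure.pi fun _ : Fin n => unlabeledLaw μ)

/-- The vector with support `S` whose nonzero entries are `ε j * √(lam / k)`, where the
`ε j` are signs. -/
noncomputable def meanVec {p : ℕ} (lam : ℝ) (k : ℕ) (ε : Fin p → ℤˣ) (S : Finset (Fin p)) :
    Fin p → ℝ :=
  fun j => if j ∈ S then ((ε j : ℤ) : ℝ) * Real.sqrt (lam / k) else 0

/-- A support estimator: a measurable map from the data to the finite set of all subsets of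
the coordinates (with its discrete sigma-algebra). -/
def IsSupportEstimator {p L n : ℕ} (Shat : Data p L n → Finset (Fin p)) : Prop :=
  ∀ T : Finset (Fin p), MeasurableSet (Shat ⁻¹' {T})

/-- The maximum over all supports `S` of size `k` of the probability that the estimator is
different from `S`, when the mean vector is `meanVec lam k ε S`. -/
noncomputable def maxErrorProb {p L n : ℕ} (lam : ℝ) (k : ℕ) (ε : Fin p → ℤˣ)
    (Shat : Data p L n → Finset (Fin p)) : ℝ≥0∞ :=
  ⨆ S ∈ Finset.powersetCard k (Finset.univ : Finset (Fin p)),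
    dataLaw (meanVec lam k ε S) L n {D | Shat D ≠ S}

instance {p : ℕ} (μ : Fin p → ℝ) : IsProbabilityMeasure (gaussianVec μ) := by
  unfold gaussianVec; infer_instance

instance {p : ℕ} (μ : Fin p → ℝ) : IsProbabilityMeasure (labeledLaw μ) := by
  constructor
  simp [labeledLaw, ENNReal.inv_two_add_inv_two]

instance {p : ℕ} (μ : Fin p → ℝ) : IsProbabilityMeasure (unlabeledLaw μ) :=
  Measure.isProbabilityMeasure_map measurable_fst.aemeasurable

instance {p : ℕ} (μ : Fin p → ℝ) (L n : ℕ) : IsProbabilityMeasure (dataLaw μ L n) := by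
  unfold dataLaw; infer_instance

end SparseMixture

/-! Fix a set `S` of `k - 1` coordinates and compare the law for `insert j S`, `j ∉ S`, with the
reference law for `S`. The `M = p - k + 1` events that the estimator outputs `insert j S` are
disjoint, so one of them has reference probability at most `1/M`. A change of measure then bounds
its probability under the law for `insert j S`.

If `f` is the likelihood ratio and `R` bounds its moment of order `1 + α` under `Q`, then `P A ≤ τ *
Q A + τ ^ (-α) * R` (`HasRatioMoment.measure_le`). Taking `α` small gives the sharp constant, which
a second moment would lose. Moments multiply over independent samples, so one sample of each kind
suffices.

Changing one coordinate from `0` to `b`, with `b² = λ/k`, costs a labeled sample a factor `exp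
(α(1+α)/2 * b²)`, an exact Gaussian computation. For an unlabeled sample the ratio is
`unlabeledRatio b T g` with `T = tanh ⟨μ, x⟩` and `g = x_j`; its variance given `T` is `T² b²` to
first order in `b²`, and the mean of `T²` is at most `min 1 |μ|²`. The factor is thus about `exp
(α(1+α)/2 * min 1 λ * b²)` (`exists_hasRatioMoment_unlabeledLaw`). Under the assumed sample sizes
the product of all factors is smaller than `τ ^ α` for `τ` slightly below `M`. -/

namespace SparseMixture

/-! ### Moments of likelihood ratios -/

section LikelihoodRatio

variable {Ω Ω' : Type*} [MeasurableSpace Ω] [MeasurableSpace Ω']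

/-- `P` has a density with respect to `Q` whose moment of order `β` under `Q` is at most `R`. -/
def HasRatioMoment (P Q : Measure Ω) (β : ℝ) (R : ℝ≥0∞) : Prop :=
  ∃ f : Ω → ℝ≥0∞, Measurable f ∧ P = Q.withDensity f ∧ ∫⁻ x, f x ^ β ∂Q ≤ R

/-- Above the threshold `τ`, the factor `(x / τ) ^ α` is at least one. -/
theorem le_add_rpow_mul_rpow {τ : ℝ≥0∞} (hτ : τ ≠ 0) (hτ' : τ ≠ ∞) {α : ℝ} (hα : 0 < α)
    (x : ℝ≥0∞) : x ≤ τ + τ ^ (-α) * x ^ (1 + α) := by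
  rcases le_or_gt x τ with h | h
  · exact h.trans le_self_add
  · refine le_trans ?_ le_add_self
    have hx0 : x ≠ 0 := (pos_of_gt h).ne'
    rcases eq_or_ne x ∞ with rfl | hxt
    · rw [ENNReal.top_rpow_of_pos (by linarith), ENNReal.mul_top]
      simp [ENNReal.rpow_eq_zero_iff, hτ, hτ', not_lt.2 hα.le]
    · calc x = x ^ (-α) * x ^ (1 + α) := by
            rw [← ENNReal.rpow_add _ _ hx0 hxt]; simp
        _ ≤ τ ^ (-α) * x ^ (1 + α) := by
            gcongr ?_ * _
            rw [ENNReal.rpow_neg, ENNReal.rpow_neg, ENNReal.inv_le_inv]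
            exact ENNReal.rpow_le_rpow h.le hα.le

theorem HasRatioMoment.measure_le {P Q : Measure Ω} {α : ℝ} {R : ℝ≥0∞} (hα : 0 < α)
    (h : HasRatioMoment P Q (1 + α) R) {τ : ℝ≥0∞} (hτ : τ ≠ 0) (hτ' : τ ≠ ∞) {A : Set Ω}
    (hA : MeasurableSet A) : P A ≤ τ * Q A + τ ^ (-α) * R := by
  obtain ⟨f, hf, rfl, hR⟩ := h
  rw [withDensity_apply _ hA]
  calc ∫⁻ x in A, f x ∂Q ≤ ∫⁻ x in A, (τ + τ ^ (-α) * f x ^ (1 + α)) ∂Q :=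
        lintegral_mono fun x => le_add_rpow_mul_rpow hτ hτ' hα _
    _ = τ * Q A + τ ^ (-α) * ∫⁻ x in A, f x ^ (1 + α) ∂Q := by
        rw [lintegral_add_left measurable_const, setLIntegral_const,
          lintegral_const_mul _ (by fun_prop)]
    _ ≤ τ * Q A + τ ^ (-α) * R := by
        gcongr
        exact (setLIntegral_le_lintegral _ _).trans hR

theorem HasRatioMoment.mono {P Q : Measure Ω} {β : ℝ} {R R' : ℝ≥0∞}
    (h : HasRatioMoment P Q β R) (hR : R ≤ R') : HasRatioMoment P Q β R' := by
  obtain ⟨f, hf, hP, hm⟩ := h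
  exact ⟨f, hf, hP, hm.trans hR⟩

theorem HasRatioMoment.prod {P Q : Measure Ω} {P' Q' : Measure Ω'} [SFinite Q] [SFinite Q']
    {β : ℝ} {R R' : ℝ≥0∞} (hβ : 0 ≤ β)
    (h : HasRatioMoment P Q β R) (h' : HasRatioMoment P' Q' β R') :
    HasRatioMoment (P.prod P') (Q.prod Q') β (R * R') := by
  obtain ⟨f, hf, rfl, hm⟩ := h
  obtain ⟨g, hg, rfl, hm'⟩ := h'
  refine ⟨fun z => f z.1 * g z.2, by fun_prop, prod_withDensity hf hg, ?_⟩
  simp_rw [ENNReal.mul_rpow_of_nonneg _ _ hβ]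
  rw [lintegral_prod_mul (f := fun x => f x ^ β) (g := fun x => g x ^ β) (by fun_prop) (by fun_prop)]
  gcongr

theorem lintegral_pi_prod {ι : Type*} [Fintype ι] {X : ι → Type*} [∀ i, MeasurableSpace (X i)]
    (Q : ∀ i, Measure (X i)) [∀ i, IsProbabilityMeasure (Q i)] {f : ∀ i, X i → ℝ≥0∞}
    (hf : ∀ i, Measurable (f i)) :
    ∫⁻ x, ∏ i, f i (x i) ∂Measure.pi Q = ∏ i, ∫⁻ x, f i x ∂Q i := by
  refine (lintegral_prod_eq_prod_lintegral_of_indepFun Finset.univ (fun i (x : ∀ i, X i) => f i (x i))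
    (iIndepFun_pi fun i => (hf i).aemeasurable)
    fun i => (hf i).comp (measurable_pi_apply i)).trans ?_
  refine Finset.prod_congr rfl fun i _ => ?_
  exact (measurePreserving_eval Q i).lintegral_comp (hf i)

theorem pi_withDensity {ι : Type*} [Fintype ι] {X : ι → Type*} [∀ i, MeasurableSpace (X i)]
    (Q : ∀ i, Measure (X i)) [∀ i, IsProbabilityMeasure (Q i)] {f : ∀ i, X i → ℝ≥0∞}
    (hf : ∀ i, Measurable (f i)) [∀ i, SigmaFinite ((Q i).withDensity (f i))] :
    Measure.pi (fun i => (Q i).withDensity (f i)) =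
      (Measure.pi Q).withDensity fun x => ∏ i, f i (x i) := by
  refine Measure.pi_eq fun s hs => ?_
  have hset : MeasurableSet (Set.univ.pi s) := MeasurableSet.univ_pi hs
  rw [withDensity_apply _ hset, ← lintegral_indicator hset]
  have : (Set.univ.pi s).indicator (fun x => ∏ i, f i (x i)) =
      fun x => ∏ i, (s i).indicator (f i) (x i) := by
    funext x
    by_cases hx : x ∈ Set.univ.pi s
    · rw [Set.indicator_of_mem hx]
      exact Finset.prod_congr rfl fun i _ => (Set.indicator_of_mem (hx i trivial) _).symm
    · rw [Set.indicator_of_notMem hx]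
      obtain ⟨i, hi⟩ : ∃ i, x i ∉ s i := by simpa using hx
      exact (Finset.prod_eq_zero (Finset.mem_univ i) (Set.indicator_of_notMem hi _)).symm
  rw [this, lintegral_pi_prod Q fun i => (hf i).indicator (hs i)]
  exact Finset.prod_congr rfl fun i _ => by
    rw [withDensity_apply _ (hs i), lintegral_indicator (hs i)]

theorem HasRatioMoment.pi {ι : Type*} [Fintype ι] {X : ι → Type*} [∀ i, MeasurableSpace (X i)]
    {P Q : ∀ i, Measure (X i)} [∀ i, IsProbabilityMeasure (P i)] [∀ i, IsProbabilityMeasure (Q i)]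
    {β : ℝ} {R : ι → ℝ≥0∞} (hβ : 0 ≤ β) (h : ∀ i, HasRatioMoment (P i) (Q i) β (R i)) :
    HasRatioMoment (Measure.pi P) (Measure.pi Q) β (∏ i, R i) := by
  choose f hf hP hm using h
  have : ∀ i, SigmaFinite ((Q i).withDensity (f i)) := fun i => by
    rw [← hP i]; infer_instance
  refine ⟨fun x => ∏ i, f i (x i), by fun_prop, ?_, ?_⟩
  · rw [← pi_withDensity Q hf]
    exact congrArg _ (funext hP)
  · simp_rw [← ENNReal.prod_rpow_of_nonneg hβ]
    rw [lintegral_pi_prod Q fun i => (hf i).pow_const β]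
    exact Finset.prod_le_prod' fun i _ => hm i

/-- The label reveals the component, so one density can use `f₁` on label `1` and `f₂` on label
`-1`; its moment is the average of the two. -/
theorem HasRatioMoment.mixture {P₁ P₂ Q₁ Q₂ : Measure Ω} [SFinite Q₁] [SFinite Q₂]
    {β : ℝ} {R : ℝ≥0∞}
    (h₁ : HasRatioMoment P₁ Q₁ β R) (h₂ : HasRatioMoment P₂ Q₂ β R) :
    HasRatioMoment
      ((2⁻¹ : ℝ≥0∞) • P₁.prod (Measure.dirac (1 : ℝ)) +
        (2⁻¹ : ℝ≥0∞) • P₂.prod (Measure.dirac (-1 : ℝ)))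
      ((2⁻¹ : ℝ≥0∞) • Q₁.prod (Measure.dirac (1 : ℝ)) +
        (2⁻¹ : ℝ≥0∞) • Q₂.prod (Measure.dirac (-1 : ℝ))) β R := by
  obtain ⟨f₁, hf₁, rfl, hm₁⟩ := h₁
  obtain ⟨f₂, hf₂, rfl, hm₂⟩ := h₂
  have hms : MeasurableSet {z : Ω × ℝ | z.2 = 1} := measurable_snd (measurableSet_singleton 1)
  have hf : Measurable fun z : Ω × ℝ => if z.2 = 1 then f₁ z.1 else f₂ z.1 :=
    Measurable.ite hms (by fun_prop) (by fun_prop)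
  have key : ∀ (Q : Measure Ω) [SFinite Q] (y : ℝ) (g : Ω × ℝ → ℝ≥0∞), Measurable g →
      (Q.prod (Measure.dirac y)).withDensity g =
        (Q.withDensity fun x => g (x, y)).prod (Measure.dirac y) := by
    intro Q _ y g hg
    have hy : Measurable fun x : Ω => (x, y) := by fun_prop
    ext s hs
    rw [withDensity_apply _ hs, Measure.prod_dirac, Measure.prod_dirac, Measure.map_apply hy hs,
      withDensity_apply _ (hy hs), setLIntegral_map hs hg hy]
  refine ⟨_, hf, ?_, ?_⟩
  · rw [withDensity_add_measure, withDensity_smul_measure, withDensity_smul_measure,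
      key _ _ _ hf, key _ _ _ hf]
    norm_num
  · rw [lintegral_add_measure, lintegral_smul_measure, lintegral_smul_measure,
      Measure.prod_dirac, Measure.prod_dirac, lintegral_map (hf.pow_const β) (by fun_prop),
      lintegral_map (hf.pow_const β) (by fun_prop)]
    norm_num only [if_true, if_false, smul_eq_mul]
    calc _ ≤ 2⁻¹ * R + 2⁻¹ * R := by
          refine add_le_add (mul_le_mul_right ?_ _) (mul_le_mul_right ?_ _)
          · simpa using hm₁
          · simpa using hm₂
      _ = R := by rw [← add_mul, ENNReal.inv_two_add_inv_two, one_mul]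

end LikelihoodRatio

/-! ### Gaussian shifts -/

theorem gaussianReal_eq_withDensity (m₁ m₀ : ℝ) :
    gaussianReal m₁ 1 = (gaussianReal m₀ 1).withDensity fun x =>
      ENNReal.ofReal (Real.exp ((m₁ - m₀) * (x - m₀) - (m₁ - m₀) ^ 2 / 2)) := by
  rw [gaussianReal_of_var_ne_zero m₁ one_ne_zero, gaussianReal_of_var_ne_zero m₀ one_ne_zero,
    ← withDensity_mul _ (measurable_gaussianPDF _ _) (by fun_prop)]
  congr 1
  funext x
  rw [Pi.mul_apply, gaussianPDF, gaussianPDF, ← ENNReal.ofReal_mul (gaussianPDFReal_nonneg _ _ _),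
    gaussianPDFReal, gaussianPDFReal,
    mul_assoc (_ : ℝ)⁻¹, ← Real.exp_add]
  congr 3
  norm_num
  ring

theorem hasRatioMoment_gaussianReal (m₁ m₀ : ℝ) {β : ℝ} (hβ : 0 ≤ β) :
    HasRatioMoment (gaussianReal m₁ 1) (gaussianReal m₀ 1) β
      (ENNReal.ofReal (Real.exp (β * (β - 1) / 2 * (m₁ - m₀) ^ 2))) := by
  refine ⟨_, by fun_prop, gaussianReal_eq_withDensity m₁ m₀, le_of_eq ?_⟩
  -- The power `β` of the density is a constant times the density of the shift by `β * (m₁ - m₀)`,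
  -- which integrates to one.
  have h1 : ∫⁻ x, ENNReal.ofReal (Real.exp
      ((m₀ + β * (m₁ - m₀) - m₀) * (x - m₀) - (m₀ + β * (m₁ - m₀) - m₀) ^ 2 / 2))
        ∂gaussianReal m₀ 1 = 1 := by
    rw [← setLIntegral_univ, ← withDensity_apply _ MeasurableSet.univ,
      ← gaussianReal_eq_withDensity]
    exact measure_univ
  conv_rhs => rw [← mul_one (ENNReal.ofReal _), ← h1]
  rw [← lintegral_const_mul _ (by fun_prop)]
  refine lintegral_congr fun x => ?_
  rw [ENNReal.ofReal_rpow_of_nonneg (Real.exp_pos _).le hβ, ← Real.exp_mul,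
    ← ENNReal.ofReal_mul (Real.exp_pos _).le, ← Real.exp_add]
  congr 2
  ring

theorem hasRatioMoment_gaussianVec {p : ℕ} (μ₁ μ₀ : Fin p → ℝ) {β : ℝ} (hβ : 0 ≤ β) :
    HasRatioMoment (gaussianVec μ₁) (gaussianVec μ₀) β
      (ENNReal.ofReal (Real.exp (β * (β - 1) / 2 * ∑ j, (μ₁ j - μ₀ j) ^ 2))) := by
  have := HasRatioMoment.pi hβ fun j => hasRatioMoment_gaussianReal (μ₁ j) (μ₀ j) hβ
  rwa [← ENNReal.ofReal_prod_of_nonneg fun _ _ => (Real.exp_pos _).le, ← Real.exp_sum,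
    ← Finset.mul_sum] at this

theorem hasRatioMoment_labeledLaw {p : ℕ} (μ₁ μ₀ : Fin p → ℝ) {β : ℝ} (hβ : 0 ≤ β) :
    HasRatioMoment (labeledLaw μ₁) (labeledLaw μ₀) β
      (ENNReal.ofReal (Real.exp (β * (β - 1) / 2 * ∑ j, (μ₁ j - μ₀ j) ^ 2))) := by
  refine (hasRatioMoment_gaussianVec μ₁ μ₀ hβ).mixture ?_
  have h : ∑ j, (μ₁ j - μ₀ j) ^ 2 = ∑ j, ((-μ₁) j - (-μ₀) j) ^ 2 :=
    Finset.sum_congr rfl fun j _ => by simp only [Pi.neg_apply]; ring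
  rw [h]
  exact hasRatioMoment_gaussianVec _ _ hβ

theorem gaussianVec_eq_withDensity {p : ℕ} (μ : Fin p → ℝ) :
    gaussianVec μ = (gaussianVec 0).withDensity fun x =>
      ENNReal.ofReal (Real.exp (∑ j, μ j * x j - (∑ j, μ j ^ 2) / 2)) := by
  have h := fun j => gaussianReal_eq_withDensity (μ j) 0
  have : ∀ j, SigmaFinite ((gaussianReal 0 1).withDensity fun x =>
      ENNReal.ofReal (Real.exp ((μ j - 0) * (x - 0) - (μ j - 0) ^ 2 / 2))) := fun j => by
    rw [← h j]; infer_instance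
  unfold gaussianVec
  simp_rw [h]
  refine (pi_withDensity (fun _ : Fin p => gaussianReal 0 1) fun j => by fun_prop).trans ?_
  congr 1
  funext x
  rw [← ENNReal.ofReal_prod_of_nonneg fun _ _ => (Real.exp_pos _).le, ← Real.exp_sum,
    Finset.sum_sub_distrib, Finset.sum_div]
  simp

/-- The density of an unlabeled sample with respect to `N(0, I_p)`, as a function of
`t = ⟨μ, x⟩` and `s = |μ|²`. -/
noncomputable def unlabeledDensity (s t : ℝ) : ℝ := Real.exp (-s / 2) * Real.cosh t

theorem unlabeledDensity_pos (s t : ℝ) : 0 < unlabeledDensity s t :=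
  mul_pos (Real.exp_pos _) (Real.cosh_pos _)

@[fun_prop]
theorem measurable_unlabeledDensity (s : ℝ) : Measurable (unlabeledDensity s) := by
  unfold unlabeledDensity; fun_prop

theorem unlabeledLaw_eq_withDensity {p : ℕ} (μ : Fin p → ℝ) :
    unlabeledLaw μ = (gaussianVec 0).withDensity fun x =>
      ENNReal.ofReal (unlabeledDensity (∑ j, μ j ^ 2) (∑ j, μ j * x j)) := by
  have h : unlabeledLaw μ = (2⁻¹ : ℝ≥0∞) • gaussianVec μ + (2⁻¹ : ℝ≥0∞) • gaussianVec (-μ) := by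
    unfold unlabeledLaw labeledLaw
    rw [Measure.map_add _ _ measurable_fst, Measure.map_smul, Measure.map_smul,
      Measure.map_fst_prod, Measure.map_fst_prod]
    simp
  rw [h, gaussianVec_eq_withDensity μ, gaussianVec_eq_withDensity (-μ),
    ← withDensity_smul _ (by fun_prop), ← withDensity_smul _ (by fun_prop),
    ← withDensity_add_left (by fun_prop)]
  congr 1
  funext x
  have h2 : (2⁻¹ : ℝ≥0∞) = ENNReal.ofReal 2⁻¹ := by
    rw [ENNReal.ofReal_inv_of_pos two_pos, ENNReal.ofReal_ofNat]
  simp only [Pi.add_apply, Pi.smul_apply, smul_eq_mul, Pi.neg_apply, h2]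
  rw [← ENNReal.ofReal_mul (by positivity), ← ENNReal.ofReal_mul (by positivity),
    ← ENNReal.ofReal_add (by positivity) (by positivity), unlabeledDensity, Real.cosh_eq]
  congr 1
  simp only [neg_mul, Finset.sum_neg_distrib, neg_sq]
  rw [sub_eq_add_neg, sub_eq_add_neg, Real.exp_add, Real.exp_add, neg_div]
  ring

/-! ### Likelihood ratios of unlabeled samples -/

/-- The difference `F` of the two sides vanishes to first order at `1` and is convex on `(1 - r,
∞)`, because `y ^ (α - 1)` decreases and is at most `1 + η` there. -/
theorem rpow_le_quadratic_of_rpow_le {α η r x : ℝ} (hα : 0 < α) (hα1 : α < 1) (hr : 0 < r)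
    (hr1 : r < 1) (hη : (1 - r) ^ (α - 1) ≤ 1 + η) (hx : 1 - r < x) :
    x ^ (1 + α) ≤ 1 + (1 + α) * (x - 1) + (1 + α) * α / 2 * (1 + η) * (x - 1) ^ 2 := by
  set K := (1 + α) * α / 2 * (1 + η) with hK
  set F : ℝ → ℝ := fun x => 1 + (1 + α) * (x - 1) + K * (x - 1) ^ 2 - x ^ (1 + α) with hF
  have hd : ∀ y, 0 < y → HasDerivAt F ((1 + α) + 2 * K * (y - 1) - (1 + α) * y ^ α) y := by
    intro y hy
    have h1 : HasDerivAt (fun x : ℝ => x - 1) 1 y := (hasDerivAt_id y).sub_const 1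
    have h2 := Real.hasDerivAt_rpow_const (x := y) (p := 1 + α) (Or.inl hy.ne')
    refine ((((h1.const_mul (1 + α)).const_add 1).add ((h1.pow 2).const_mul K)).sub h2).congr_deriv
      ?_
    rw [add_sub_cancel_left]
    norm_num
    ring
  have hd2 : ∀ y, 0 < y → HasDerivAt (fun y => (1 + α) + 2 * K * (y - 1) - (1 + α) * y ^ α)
      (2 * K - (1 + α) * (α * y ^ (α - 1))) y := by
    intro y hy
    have h1 : HasDerivAt (fun x : ℝ => x - 1) 1 y := (hasDerivAt_id y).sub_const 1
    have h2 := Real.hasDerivAt_rpow_const (x := y) (p := α) (Or.inl hy.ne')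
    refine (((h1.const_mul (2 * K)).const_add (1 + α)).sub (h2.const_mul (1 + α))).congr_deriv ?_
    ring
  have hpos : ∀ y ∈ Set.Ioi (1 - r), 0 < y := fun y hy => by
    have : 1 - r < y := hy
    linarith
  have hconv : ConvexOn ℝ (Set.Ioi (1 - r)) F := by
    refine convexOn_of_hasDerivWithinAt2_nonneg (convex_Ioi _)
      (fun y hy => (hd y (hpos y hy)).continuousAt.continuousWithinAt)
      (f' := fun y => (1 + α) + 2 * K * (y - 1) - (1 + α) * y ^ α)
      (f'' := fun y => 2 * K - (1 + α) * (α * y ^ (α - 1))) ?_ ?_ ?_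
    · rw [interior_Ioi]
      exact fun y hy => (hd y (hpos y hy)).hasDerivWithinAt
    · rw [interior_Ioi]
      exact fun y hy => (hd2 y (hpos y hy)).hasDerivWithinAt
    · rw [interior_Ioi]
      intro y hy
      have h1 : y ^ (α - 1) ≤ 1 + η :=
        (Real.rpow_le_rpow_of_nonpos (by linarith) (le_of_lt hy) (by linarith)).trans hη
      have h2 : (1 + α) * α * y ^ (α - 1) ≤ (1 + α) * α * (1 + η) := by gcongr
      rw [hK]
      linarith
  have h1mem : (1 : ℝ) ∈ Set.Ioi (1 - r) := by simpa using hr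
  have hd1 : HasDerivAt F 0 1 := by
    refine (hd 1 one_pos).congr_deriv ?_
    simp
  have hF1 : F 1 = 0 := by simp [hF]
  have : 0 ≤ F x := by
    rcases lt_trichotomy x 1 with h | rfl | h
    · have := hconv.slope_le_of_hasDerivAt hx h1mem h hd1
      rw [slope_def_field, hF1] at this
      have h3 := (div_nonpos_iff).1 this
      rcases h3 with h3 | h3 <;> linarith
    · exact hF1.ge
    · have := hconv.le_slope_of_hasDerivAt h1mem hx h hd1
      rw [slope_def_field, hF1] at this
      have h3 := (div_nonneg_iff).1 this
      rcases h3 with h3 | h3 <;> linarith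
  simp only [hF] at this
  linarith

/-- The quadratic coefficient stays within `1 + η` of the Taylor one. Far below `1`, Bernoulli's
inequality leaves an excess `α * (x - 1) ^ 2`, which the quartic term absorbs since `|x - 1| ≥ r`.
The quartic term will only cost `O(b⁴)`. -/
theorem exists_rpow_le_quartic {α η : ℝ} (hα : 0 < α) (hα1 : α < 1) (hη : 0 < η) :
    ∃ C : ℝ, 0 ≤ C ∧ ∀ x : ℝ, 0 ≤ x → x ^ (1 + α) ≤ 1 + (1 + α) * (x - 1) +
      (1 + α) * α / 2 * (1 + η) * (x - 1) ^ 2 + C * (x - 1) ^ 4 := by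
  obtain ⟨r, hr, hr1, hrη⟩ : ∃ r : ℝ, 0 < r ∧ r < 1 ∧ (1 - r) ^ (α - 1) ≤ 1 + η := by
    have hc : Tendsto (fun r : ℝ => (1 - r) ^ (α - 1)) (𝓝[>] 0) (𝓝 1) := by
      have : ContinuousAt (fun r : ℝ => (1 - r) ^ (α - 1)) 0 :=
        ContinuousAt.rpow_const (by fun_prop) (Or.inl (by norm_num))
      have h := this.tendsto.mono_left (nhdsWithin_le_nhds (s := Set.Ioi 0))
      simpa using h
    obtain ⟨r, h1, h2, h3⟩ := ((hc.eventually_le_const (by linarith : 1 < 1 + η)).and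
      ((eventually_mem_nhdsWithin).and
        (nhdsWithin_le_nhds (eventually_lt_nhds (zero_lt_one' ℝ))))).exists
    exact ⟨r, h2, h3, h1⟩
  refine ⟨α / r ^ 2, by positivity, fun x hx => ?_⟩
  rcases lt_or_ge (1 - r) x with h | h
  · have := rpow_le_quadratic_of_rpow_le hα hα1 hr hr1 hrη h
    have h4 : 0 ≤ α / r ^ 2 * (x - 1) ^ 4 := by positivity
    linarith
  · have h1 : x ^ (1 + α) ≤ x * (1 + α * (x - 1)) := by
      rw [Real.rpow_one_add' hx (by linarith)]
      gcongr
      have := rpow_one_add_le_one_add_mul_self (s := x - 1) (by linarith) hα.le hα1.le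
      rwa [add_sub_cancel] at this
    have h2 : α * (x - 1) ^ 2 ≤ α / r ^ 2 * (x - 1) ^ 4 := by
      rw [div_mul_eq_mul_div, le_div_iff₀ (by positivity)]
      have : r ^ 2 ≤ (x - 1) ^ 2 := by nlinarith
      nlinarith [mul_nonneg hα.le (sq_nonneg (x - 1))]
    have h3 : 0 ≤ (1 + α) * α / 2 * (1 + η) * (x - 1) ^ 2 := by positivity
    nlinarith

/-- `f` is integrable under the standard Gaussian law, with integral `r`. -/
def HasGaussianIntegral (f : ℝ → ℝ) (r : ℝ) : Prop :=
  Integrable f (gaussianReal 0 1) ∧ ∫ x, f x ∂gaussianReal 0 1 = r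

theorem HasGaussianIntegral.add {f g : ℝ → ℝ} {r s : ℝ} (hf : HasGaussianIntegral f r)
    (hg : HasGaussianIntegral g s) : HasGaussianIntegral (fun x => f x + g x) (r + s) :=
  ⟨hf.1.add hg.1, by rw [integral_add hf.1 hg.1, hf.2, hg.2]⟩

theorem HasGaussianIntegral.const_mul {f : ℝ → ℝ} {r : ℝ} (hf : HasGaussianIntegral f r)
    (c : ℝ) : HasGaussianIntegral (fun x => c * f x) (c * r) :=
  ⟨hf.1.const_mul c, by rw [integral_const_mul, hf.2]⟩

theorem hasGaussianIntegral_const (c : ℝ) : HasGaussianIntegral (fun _ => c) c :=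
  ⟨integrable_const c, by simp⟩

theorem hasGaussianIntegral_exp_pow (b : ℝ) (m : ℕ) :
    HasGaussianIntegral (fun x => Real.exp (b * x - b ^ 2 / 2) ^ m)
      (Real.exp (((m : ℝ) ^ 2 - m) * b ^ 2 / 2)) := by
  have h : (fun x : ℝ => Real.exp (b * x - b ^ 2 / 2) ^ m) =
      fun x => Real.exp (-(m * b ^ 2 / 2)) * Real.exp ((m * b) * x) := by
    funext x
    rw [← Real.exp_nat_mul, ← Real.exp_add]
    congr 1
    ring
  rw [h]
  refine ⟨(integrable_exp_mul_gaussianReal _).const_mul _, ?_⟩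
  have h2 : ∫ x, Real.exp ((m * b) * x) ∂gaussianReal 0 1 = Real.exp ((m * b) ^ 2 / 2) := by
    have := mgf_gaussianReal (p := gaussianReal 0 1) (X := id) (μ := 0) (v := 1)
      Measure.map_id (m * b)
    simpa [mgf] using this
  rw [integral_const_mul, h2, ← Real.exp_add]
  congr 1
  ring

/-- The likelihood ratio of one unlabeled sample when one coordinate of the mean vector is changed
from `0` to `b`: here `g` is that coordinate of the sample and `T` is the hyperbolic tangent of its
inner product with the mean vector. -/
noncomputable def unlabeledRatio (b T g : ℝ) : ℝ :=
  Real.exp (-b ^ 2 / 2) * (Real.cosh (b * g) + T * Real.sinh (b * g))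

/-- For `|T| ≤ 1` this is a convex combination of the likelihood ratios of `N(b, 1)` and `N(-b, 1)`
against `N(0, 1)`. -/
theorem unlabeledRatio_eq (b T g : ℝ) : unlabeledRatio b T g =
    (1 + T) / 2 * Real.exp (b * g - b ^ 2 / 2) +
      (1 - T) / 2 * Real.exp ((-b) * g - (-b) ^ 2 / 2) := by
  have h1 : Real.exp (b * g - b ^ 2 / 2) = Real.exp (-b ^ 2 / 2) * Real.exp (b * g) := by
    rw [← Real.exp_add]; congr 1; ring
  have h2 : Real.exp ((-b) * g - (-b) ^ 2 / 2) = Real.exp (-b ^ 2 / 2) * Real.exp (-(b * g)) := by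
    rw [← Real.exp_add]; congr 1; ring
  rw [unlabeledRatio, h1, h2, Real.cosh_eq, Real.sinh_eq]
  ring

theorem unlabeledRatio_nonneg {b T g : ℝ} (hT : |T| ≤ 1) : 0 ≤ unlabeledRatio b T g := by
  obtain ⟨h1, h2⟩ := abs_le.1 hT
  rw [unlabeledRatio_eq]
  have h3 : 0 ≤ (1 + T) / 2 := by linarith
  have h4 : 0 ≤ (1 - T) / 2 := by linarith
  positivity

@[fun_prop]
theorem measurable_unlabeledRatio (b : ℝ) :
    Measurable fun z : ℝ × ℝ => unlabeledRatio b z.1 z.2 := by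
  unfold unlabeledRatio; fun_prop

theorem convexComb_pow_four_le {a c x y : ℝ} (ha : 0 ≤ a) (hc : 0 ≤ c) (hac : a + c = 1) :
    (a * x + c * y) ^ 4 ≤ a * x ^ 4 + c * y ^ 4 := by
  have := (Even.convexOn_pow (𝕜 := ℝ) (n := 4) (by decide)).2 (Set.mem_univ x) (Set.mem_univ y)
    ha hc hac
  simpa using this

/-- The polynomial bound is integrated exactly, after convexity splits the fourth power between the
two exponentials `u` and `v`. -/
theorem lintegral_unlabeledRatio_rpow_le {α K C : ℝ}
    (hC : 0 ≤ C) (hpoly : ∀ x : ℝ, 0 ≤ x → x ^ (1 + α) ≤ 1 + (1 + α) * (x - 1) +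
      K * (x - 1) ^ 2 + C * (x - 1) ^ 4) (b : ℝ) {T : ℝ} (hT : |T| ≤ 1) :
    ∫⁻ g, ENNReal.ofReal (unlabeledRatio b T g ^ (1 + α)) ∂gaussianReal 0 1 ≤
      ENNReal.ofReal (1 + K * (Real.cosh (b ^ 2) - 1 + T ^ 2 * Real.sinh (b ^ 2)) +
        C * (Real.exp (6 * b ^ 2) - 4 * Real.exp (3 * b ^ 2) + 6 * Real.exp (b ^ 2) - 3)) := by
  obtain ⟨hT1, hT2⟩ := abs_le.1 hT
  set a := (1 + T) / 2 with ha
  set c := (1 - T) / 2 with hc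
  have ha0 : 0 ≤ a := by rw [ha]; linarith
  have hc0 : 0 ≤ c := by rw [hc]; linarith
  have hac : a + c = 1 := by rw [ha, hc]; ring
  set u : ℝ → ℝ := fun g => Real.exp (b * g - b ^ 2 / 2) with hu
  set v : ℝ → ℝ := fun g => Real.exp ((-b) * g - (-b) ^ 2 / 2) with hv
  -- The only cross term, from the square, is therefore constant in `g`.
  have huv : ∀ g, u g * v g = Real.exp (-b ^ 2) := fun g => by
    simp only [hu, hv, ← Real.exp_add]; congr 1; ring
  have hU := hasGaussianIntegral_exp_pow b
  have hV := hasGaussianIntegral_exp_pow (-b)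
  have hlin : ∀ d1 d2 d3 d4 e1 e2 e3 e4 d0 : ℝ, HasGaussianIntegral
      (fun g => d0 + (d1 * u g ^ 1 + (d2 * u g ^ 2 + (d3 * u g ^ 3 + (d4 * u g ^ 4 +
        (e1 * v g ^ 1 + (e2 * v g ^ 2 + (e3 * v g ^ 3 + e4 * v g ^ 4)))))))) _ :=
    fun d1 d2 d3 d4 e1 e2 e3 e4 d0 =>
    (hasGaussianIntegral_const d0).add <| ((hU 1).const_mul d1).add <|
    ((hU 2).const_mul d2).add <| ((hU 3).const_mul d3).add <| ((hU 4).const_mul d4).add <|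
    ((hV 1).const_mul e1).add <| ((hV 2).const_mul e2).add <| ((hV 3).const_mul e3).add <|
    ((hV 4).const_mul e4)
  have hmain : HasGaussianIntegral (fun g => 1 + (1 + α) * (a * u g + c * v g - 1) +
      K * (a * u g + c * v g - 1) ^ 2 + C * (a * (u g - 1) ^ 4 + c * (v g - 1) ^ 4))
      (1 + K * (Real.cosh (b ^ 2) - 1 + T ^ 2 * Real.sinh (b ^ 2)) +
        C * (Real.exp (6 * b ^ 2) - 4 * Real.exp (3 * b ^ 2) + 6 * Real.exp (b ^ 2) - 3)) := by
    convert hlin ((1 + α) * a - 2 * K * a - 4 * C * a) (K * a ^ 2 + 6 * C * a) (-4 * C * a) (C * a)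
      ((1 + α) * c - 2 * K * c - 4 * C * c) (K * c ^ 2 + 6 * C * c) (-4 * C * c) (C * c)
      (1 - (1 + α) + K + C + 2 * K * a * c * Real.exp (-b ^ 2)) using 1
    · funext g
      rw [← huv g]
      linear_combination C * hac
    · have e1 : (((1 : ℕ) : ℝ) ^ 2 - (1 : ℕ)) * b ^ 2 / 2 = 0 := by norm_num
      have e2 : (((2 : ℕ) : ℝ) ^ 2 - (2 : ℕ)) * b ^ 2 / 2 = b ^ 2 := by push_cast; ring
      have e3 : (((3 : ℕ) : ℝ) ^ 2 - (3 : ℕ)) * b ^ 2 / 2 = 3 * b ^ 2 := by push_cast; ring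
      have e4 : (((4 : ℕ) : ℝ) ^ 2 - (4 : ℕ)) * b ^ 2 / 2 = 6 * b ^ 2 := by push_cast; ring
      rw [neg_sq, e1, e2, e3, e4, Real.exp_zero, Real.cosh_eq, Real.sinh_eq, ha, hc]
      ring
  have hbound : ∀ g, unlabeledRatio b T g ^ (1 + α) ≤ 1 + (1 + α) * (a * u g + c * v g - 1) +
      K * (a * u g + c * v g - 1) ^ 2 + C * (a * (u g - 1) ^ 4 + c * (v g - 1) ^ 4) := by
    intro g
    have h1 := hpoly _ (unlabeledRatio_nonneg (b := b) (g := g) hT)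
    rw [unlabeledRatio_eq] at h1
    have h2 : (a * u g + c * v g - 1) ^ 4 ≤ a * (u g - 1) ^ 4 + c * (v g - 1) ^ 4 := by
      have h3 : a * u g + c * v g - 1 = a * (u g - 1) + c * (v g - 1) := by
        linear_combination -hac
      rw [h3]
      exact convexComb_pow_four_le ha0 hc0 hac
    rw [unlabeledRatio_eq]
    exact h1.trans (add_le_add_right (mul_le_mul_of_nonneg_left h2 hC) _)
  calc _ ≤ ∫⁻ g, ENNReal.ofReal (1 + (1 + α) * (a * u g + c * v g - 1) +
      K * (a * u g + c * v g - 1) ^ 2 + C * (a * (u g - 1) ^ 4 + c * (v g - 1) ^ 4))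
        ∂gaussianReal 0 1 := lintegral_mono fun g => ENNReal.ofReal_le_ofReal (hbound g)
    _ = _ := by
      rw [← ofReal_integral_eq_lintegral_ofReal hmain.1, hmain.2]
      exact ae_of_all _ fun g =>
        (Real.rpow_nonneg (unlabeledRatio_nonneg hT) _).trans (hbound g)

/-- Only `sinh` has a first-order term at `0`: in the last bracket the derivatives cancel as `6 - 12
+ 6`. The slack `η` covers the remainder, and `1 + x ≤ exp x` concludes. -/
theorem exists_forall_unlabeledRatio_bound_le {K C m η : ℝ} (hK : 0 < K) (hm : 0 < m)
    (hη : 0 < η) :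
    ∃ r : ℝ, 0 < r ∧ ∀ v ∈ Set.Ioo 0 r,
      1 + K * (Real.cosh v - 1 + m * Real.sinh v) +
        C * (Real.exp (6 * v) - 4 * Real.exp (3 * v) + 6 * Real.exp v - 3) ≤
      Real.exp (K * (1 + η) * m * v) := by
  set G : ℝ → ℝ := fun v => K * (Real.cosh v - 1 + m * Real.sinh v) +
        C * (Real.exp (6 * v) - 4 * Real.exp (3 * v) + 6 * Real.exp v - 3) with hG
  have hd : HasDerivAt G (K * m) 0 := by
    have h6 : ∀ d : ℝ, HasDerivAt (fun v : ℝ => Real.exp (d * v)) d 0 := fun d => by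
      have := ((hasDerivAt_id (0 : ℝ)).const_mul d).exp
      simpa using this
    have h1 := Real.hasDerivAt_exp 0
    have hc := Real.hasDerivAt_cosh 0
    have hs := Real.hasDerivAt_sinh 0
    refine ((((hc.sub_const 1).add (hs.const_mul m)).const_mul K).add
      (((((h6 6).sub ((h6 3).const_mul 4)).add (h1.const_mul 6)).sub_const 3).const_mul C)).congr_deriv
      ?_
    norm_num
  have hslope := (hasDerivAt_iff_tendsto_slope.1 hd).mono_left
    (nhdsWithin_mono 0 (fun x (hx : 0 < x) => hx.ne'))
  have hlt : K * m < K * (1 + η) * m := by nlinarith [mul_pos hK hm, mul_pos (mul_pos hK hm) hη]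
  have hev := hslope.eventually_le_const hlt
  obtain ⟨r, hr, hr2⟩ := mem_nhdsGT_iff_exists_Ioo_subset.1 hev
  refine ⟨r, hr, fun v hv => ?_⟩
  have h1 : slope G 0 v ≤ K * (1 + η) * m := hr2 hv
  have hG0 : G 0 = 0 := by simp [hG]; norm_num
  rw [slope_def_field, hG0, sub_zero, sub_zero, div_le_iff₀ hv.1] at h1
  have h2 := Real.add_one_le_exp (K * (1 + η) * m * v)
  simp only [hG] at h1
  linarith

/-! ### Adding a coordinate to the mean of an unlabeled sample -/

theorem unlabeledDensity_add (s t b g : ℝ) :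
    unlabeledDensity (s + b ^ 2) (t + b * g) =
      unlabeledDensity s t * unlabeledRatio b (Real.tanh t) g := by
  have h : Real.exp (-(s + b ^ 2) / 2) = Real.exp (-s / 2) * Real.exp (-b ^ 2 / 2) := by
    rw [← Real.exp_add]; congr 1; ring
  have hc := (Real.cosh_pos t).ne'
  rw [unlabeledDensity, unlabeledDensity, unlabeledRatio, h, Real.cosh_add,
    Real.tanh_eq_sinh_div_cosh]
  field_simp

/-- The difference of the sides is a square times a positive factor. As the density integrates to
one, this bounds the mean of `tanh²` by `1 - exp (-s) ≤ s`. -/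
theorem unlabeledDensity_mul_tanh_sq_le (s t : ℝ) :
    unlabeledDensity s t * Real.tanh t ^ 2 ≤
      (1 + Real.exp (-s)) * unlabeledDensity s t - 2 * Real.exp (-s) := by
  have hc := Real.cosh_pos t
  have hD : Real.exp (-s) = Real.exp (-s / 2) ^ 2 := by
    rw [← Real.exp_nat_mul]; congr 1; push_cast; ring
  have hs := Real.sinh_sq t
  have hw := Real.exp_pos (-s / 2)
  rw [unlabeledDensity, Real.tanh_eq_sinh_div_cosh, hD, div_pow, hs]
  set w := Real.exp (-s / 2)
  set c := Real.cosh t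
  have : (1 + w ^ 2) * (w * c) - 2 * w ^ 2 - w * c * ((c ^ 2 - 1) / c ^ 2) =
      w * (w * c - 1) ^ 2 / c := by
    field_simp
    ring
  have h2 : 0 ≤ w * (w * c - 1) ^ 2 / c := by positivity
  linarith

theorem map_sum_prod_eval_gaussianVec {p : ℕ} (μ : Fin p → ℝ) {j : Fin p} (hj : μ j = 0) :
    (gaussianVec 0).map (fun x => (∑ i, μ i * x i, x j)) =
      ((gaussianVec 0).map fun x => ∑ i, μ i * x i).prod (gaussianReal 0 1) := by
  have hmap : (gaussianVec (0 : Fin p → ℝ)).map (fun x => x j) = gaussianReal 0 1 :=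
    (measurePreserving_eval (fun _ : Fin p => gaussianReal 0 1) j).map_eq
  -- The coefficient at `j`, where `μ` vanishes, is replaced by `1` so that the family contains `x
  -- j` itself.
  have hind : iIndepFun (fun i (x : Fin p → ℝ) => (if i = j then 1 else μ i) * x i)
      (gaussianVec (0 : Fin p → ℝ)) :=
    iIndepFun_pi (μ := fun _ : Fin p => gaussianReal 0 1)
      (X := fun i y => (if i = j then 1 else μ i) * y) fun i => by fun_prop
  have h := hind.indepFun_finsetSum_of_notMem (fun i => by fun_prop)
    (Finset.notMem_erase j Finset.univ)
  have hsum : (∑ i ∈ Finset.univ.erase j, fun x : Fin p → ℝ =>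
      (if i = j then 1 else μ i) * x i) = fun x => ∑ i, μ i * x i := by
    funext x
    rw [Finset.sum_apply, ← Finset.add_sum_erase _ _ (Finset.mem_univ j), hj, zero_mul, zero_add]
    exact Finset.sum_congr rfl fun i hi => by rw [if_neg (Finset.ne_of_mem_erase hi)]
  have hone : (fun x : Fin p → ℝ => (if j = j then 1 else μ j) * x j) = fun x => x j := by
    funext x; simp
  rw [hsum, hone] at h
  have hm1 : Measurable fun x : Fin p → ℝ => ∑ i, μ i * x i := by fun_prop
  have hm2 : Measurable fun x : Fin p → ℝ => x j := by fun_prop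
  rw [h.map_prod_eq_prod_map_map hm1.aemeasurable hm2.aemeasurable, hmap]

theorem integrable_unlabeledDensity {p : ℕ} (μ : Fin p → ℝ) :
    Integrable (fun x => unlabeledDensity (∑ j, μ j ^ 2) (∑ j, μ j * x j)) (gaussianVec 0) ∧
      ∫ x, unlabeledDensity (∑ j, μ j ^ 2) (∑ j, μ j * x j) ∂gaussianVec 0 = 1 := by
  have h1 : ∫⁻ x, ENNReal.ofReal (unlabeledDensity (∑ j, μ j ^ 2) (∑ j, μ j * x j))
      ∂gaussianVec 0 = 1 := by
    rw [← setLIntegral_univ, ← withDensity_apply _ MeasurableSet.univ,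
      ← unlabeledLaw_eq_withDensity]
    exact measure_univ
  have hm : Measurable fun x : Fin p → ℝ =>
      unlabeledDensity (∑ j, μ j ^ 2) (∑ j, μ j * x j) := by fun_prop
  have hpos := fun x : Fin p → ℝ => (unlabeledDensity_pos (∑ j, μ j ^ 2) (∑ j, μ j * x j)).le
  constructor
  · refine ⟨hm.aestronglyMeasurable, ?_⟩
    rw [hasFiniteIntegral_iff_ofReal (ae_of_all _ hpos), h1]
    exact ENNReal.one_lt_top
  · rw [integral_eq_lintegral_of_nonneg_ae (ae_of_all _ hpos) hm.aestronglyMeasurable, h1,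
      ENNReal.toReal_one]

theorem abs_tanh_le_one (t : ℝ) : |Real.tanh t| ≤ 1 :=
  (Real.abs_tanh_lt_one t).le

/-- The two cases of `hm` use `tanh² ≤ 1` and the bound by `|μ|²`; together they produce the factor
`min 1 λ`. -/
theorem lintegral_unlabeledDensity_mul_le {p : ℕ} (μ : Fin p → ℝ) {A B m : ℝ} (hA : 0 ≤ A)
    (hB : 0 ≤ B) (hm : 1 ≤ m ∨ ∑ j, μ j ^ 2 ≤ m) :
    ∫⁻ x, ENNReal.ofReal (unlabeledDensity (∑ j, μ j ^ 2) (∑ j, μ j * x j) *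
      (A + B * Real.tanh (∑ j, μ j * x j) ^ 2)) ∂gaussianVec 0 ≤ ENNReal.ofReal (A + B * m) := by
  obtain ⟨hi, hi1⟩ := integrable_unlabeledDensity μ
  set s := ∑ j, μ j ^ 2
  obtain ⟨c, d, hcd, hle⟩ : ∃ c d : ℝ, c + d ≤ m ∧ ∀ t,
      unlabeledDensity s t * Real.tanh t ^ 2 ≤ c * unlabeledDensity s t + d := by
    rcases hm with hm | hm
    · refine ⟨1, 0, by linarith, fun t => ?_⟩
      have h1 : Real.tanh t ^ 2 ≤ 1 := (sq_le_one_iff_abs_le_one _).2 (abs_tanh_le_one t)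
      nlinarith [unlabeledDensity_pos s t]
    · refine ⟨1 + Real.exp (-s), -(2 * Real.exp (-s)), ?_, fun t => ?_⟩
      · have := Real.add_one_le_exp (-s)
        linarith
      · exact (unlabeledDensity_mul_tanh_sq_le s t).trans_eq (sub_eq_add_neg _ _)
  have hle2 : ∀ t, unlabeledDensity s t * (A + B * Real.tanh t ^ 2) ≤
      (A + B * c) * unlabeledDensity s t + B * d := fun t => by
    nlinarith [mul_le_mul_of_nonneg_left (hle t) hB]
  have hint := (hi.const_mul (A + B * c)).add (integrable_const (B * d))
  calc _ ≤ ∫⁻ x, ENNReal.ofReal ((A + B * c) * unlabeledDensity s (∑ j, μ j * x j) + B * d)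
        ∂gaussianVec 0 := lintegral_mono fun x => ENNReal.ofReal_le_ofReal (hle2 _)
    _ = ENNReal.ofReal ((A + B * c) * 1 + B * d) := by
      refine (ofReal_integral_eq_lintegral_ofReal hint (ae_of_all _ fun x => ?_)).symm.trans ?_
      · refine le_trans ?_ (hle2 (∑ j, μ j * x j))
        have := unlabeledDensity_pos s (∑ j, μ j * x j)
        positivity
      · congr 1
        refine (integral_add (hi.const_mul _) (integrable_const _)).trans ?_
        rw [integral_const_mul, hi1]
        simp
    _ ≤ ENNReal.ofReal (A + B * m) := by
      refine ENNReal.ofReal_le_ofReal ?_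
      nlinarith

/-- Under `N(0, I_p)`, `x j` is independent of `⟨μ₀, x⟩`, so `x j` is integrated first with the
inner product frozen. One factor `1 + η` comes from the quartic bound, the other from the
exponential bound. The threshold `r` does not depend on the dimension or the means. -/
theorem exists_hasRatioMoment_unlabeledLaw {α η m : ℝ} (hα : 0 < α) (hα1 : α < 1) (hη : 0 < η)
    (hm : 0 < m) :
    ∃ r : ℝ, 0 < r ∧ ∀ (p : ℕ) (μ₁ μ₀ : Fin p → ℝ) (j : Fin p), (∀ i, i ≠ j → μ₁ i = μ₀ i) →
      μ₀ j = 0 → (1 ≤ m ∨ ∑ i, μ₀ i ^ 2 ≤ m) → μ₁ j ^ 2 ∈ Set.Ioo 0 r →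
      HasRatioMoment (unlabeledLaw μ₁) (unlabeledLaw μ₀) (1 + α) (ENNReal.ofReal
        (Real.exp ((1 + α) * α / 2 * (1 + η) * (1 + η) * m * μ₁ j ^ 2))) := by
  obtain ⟨C, hC, hpoly⟩ := exists_rpow_le_quartic hα hα1 hη
  have hK : 0 < (1 + α) * α / 2 * (1 + η) := by positivity
  obtain ⟨r, hr, hbound⟩ := exists_forall_unlabeledRatio_bound_le (C := C) hK hm hη
  refine ⟨r, hr, fun p μ₁ μ₀ j hne hj hs hb => ?_⟩
  set K := (1 + α) * α / 2 * (1 + η)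
  set b := μ₁ j
  have hsum1 : ∑ i, μ₁ i ^ 2 = ∑ i, μ₀ i ^ 2 + b ^ 2 := by
    rw [← Finset.add_sum_erase _ _ (Finset.mem_univ j),
      ← Finset.add_sum_erase _ (fun i => μ₀ i ^ 2) (Finset.mem_univ j), hj,
      Finset.sum_congr rfl fun i hi => by rw [hne i (Finset.ne_of_mem_erase hi)]]
    ring
  have hsum2 : ∀ x : Fin p → ℝ, ∑ i, μ₁ i * x i = ∑ i, μ₀ i * x i + b * x j := fun x => by
    rw [← Finset.add_sum_erase _ _ (Finset.mem_univ j),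
      ← Finset.add_sum_erase _ (fun i => μ₀ i * x i) (Finset.mem_univ j), hj,
      Finset.sum_congr rfl fun i hi => by rw [hne i (Finset.ne_of_mem_erase hi)]]
    ring
  have htanh : Measurable Real.tanh := by
    rw [funext Real.tanh_eq_sinh_div_cosh]
    fun_prop
  have hXm : Measurable fun z : ℝ × ℝ => unlabeledRatio b (Real.tanh z.1) z.2 :=
    (measurable_unlabeledRatio b).comp (by fun_prop : Measurable fun z : ℝ × ℝ =>
      (Real.tanh z.1, z.2))
  have hf : Measurable fun x : Fin p → ℝ =>
      ENNReal.ofReal (unlabeledRatio b (Real.tanh (∑ i, μ₀ i * x i)) (x j)) :=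
    (hXm.comp (by fun_prop : Measurable fun x : Fin p → ℝ => (∑ i, μ₀ i * x i, x j))).ennreal_ofReal
  refine ⟨_, hf, ?_, ?_⟩
  · rw [unlabeledLaw_eq_withDensity μ₁, unlabeledLaw_eq_withDensity μ₀,
      ← withDensity_mul _ (by fun_prop) hf]
    congr 1
    funext x
    rw [Pi.mul_apply, ← ENNReal.ofReal_mul (unlabeledDensity_pos _ _).le, hsum1, hsum2,
      unlabeledDensity_add]
  · set s := ∑ i, μ₀ i ^ 2
    set A := 1 + K * (Real.cosh (b ^ 2) - 1) +
      C * (Real.exp (6 * b ^ 2) - 4 * Real.exp (3 * b ^ 2) + 6 * Real.exp (b ^ 2) - 3)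
    set B := K * Real.sinh (b ^ 2)
    have hB : 0 ≤ B := mul_nonneg hK.le (Real.sinh_nonneg_iff.2 (sq_nonneg b))
    have hA : 0 ≤ A := by
      have h1 : 1 ≤ Real.cosh (b ^ 2) := Real.one_le_cosh _
      have h2 : 0 ≤ Real.exp (6 * b ^ 2) - 4 * Real.exp (3 * b ^ 2) + 6 * Real.exp (b ^ 2) - 3 := by
        have h6 : Real.exp (6 * b ^ 2) = Real.exp (b ^ 2) ^ 6 := by
          rw [← Real.exp_nat_mul]; norm_num
        have h3 : Real.exp (3 * b ^ 2) = Real.exp (b ^ 2) ^ 3 := by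
          rw [← Real.exp_nat_mul]; norm_num
        rw [h6, h3]
        have hw : 1 ≤ Real.exp (b ^ 2) := Real.one_le_exp (sq_nonneg b)
        set w := Real.exp (b ^ 2)
        have : w ^ 6 - 4 * w ^ 3 + 6 * w - 3 =
            (w - 1) ^ 2 * (w ^ 4 + 2 * w ^ 3 + 3 * (w ^ 2 - 1)) := by ring
        rw [this]
        have : 0 ≤ w ^ 2 - 1 := by nlinarith
        positivity
      have h3 := mul_nonneg hK.le (sub_nonneg.2 h1)
      have h4 := mul_nonneg hC h2
      simp only [A]
      linarith
    have hin : ∀ t, ∫⁻ g, ENNReal.ofReal (unlabeledRatio b (Real.tanh t) g ^ (1 + α))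
        ∂gaussianReal 0 1 ≤ ENNReal.ofReal (A + B * Real.tanh t ^ 2) := fun t => by
      refine (lintegral_unlabeledRatio_rpow_le hC hpoly b (abs_tanh_le_one t)).trans_eq ?_
      congr 1
      simp only [A, B]
      ring
    have hH : Measurable fun z : ℝ × ℝ => ENNReal.ofReal (unlabeledDensity s z.1) *
        ENNReal.ofReal (unlabeledRatio b (Real.tanh z.1) z.2 ^ (1 + α)) := by fun_prop
    have hG : Measurable fun t : ℝ => ENNReal.ofReal (unlabeledDensity s t) *
        ENNReal.ofReal (A + B * Real.tanh t ^ 2) := by fun_prop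
    rw [unlabeledLaw_eq_withDensity μ₀,
      lintegral_withDensity_eq_lintegral_mul _ (by fun_prop) (hf.pow_const _)]
    calc _ = ∫⁻ x, (fun z : ℝ × ℝ => ENNReal.ofReal (unlabeledDensity s z.1) *
          ENNReal.ofReal (unlabeledRatio b (Real.tanh z.1) z.2 ^ (1 + α)))
            (∑ i, μ₀ i * x i, x j) ∂gaussianVec 0 := by
          refine lintegral_congr fun x => ?_
          rw [Pi.mul_apply, ENNReal.ofReal_rpow_of_nonneg
            (unlabeledRatio_nonneg (abs_tanh_le_one _)) (by linarith)]
      _ = ∫⁻ t, ∫⁻ g, ENNReal.ofReal (unlabeledDensity s t) *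
          ENNReal.ofReal (unlabeledRatio b (Real.tanh t) g ^ (1 + α)) ∂gaussianReal 0 1
            ∂((gaussianVec 0).map fun x => ∑ i, μ₀ i * x i) := by
          rw [← lintegral_map hH (by fun_prop), map_sum_prod_eval_gaussianVec μ₀ hj,
            lintegral_prod _ hH.aemeasurable]
      _ ≤ ∫⁻ t, ENNReal.ofReal (unlabeledDensity s t) *
          ENNReal.ofReal (A + B * Real.tanh t ^ 2)
            ∂((gaussianVec 0).map fun x => ∑ i, μ₀ i * x i) := by
          refine lintegral_mono fun t => ?_
          rw [lintegral_const_mul]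
          · gcongr
            exact hin t
          · exact ((hXm.comp (by fun_prop : Measurable fun g : ℝ => (t, g))).pow_const
              _).ennreal_ofReal
      _ = ∫⁻ x, ENNReal.ofReal (unlabeledDensity s (∑ i, μ₀ i * x i) *
          (A + B * Real.tanh (∑ i, μ₀ i * x i) ^ 2)) ∂gaussianVec 0 := by
          rw [lintegral_map hG (by fun_prop)]
          exact lintegral_congr fun x => (ENNReal.ofReal_mul (unlabeledDensity_pos _ _).le).symm
      _ ≤ ENNReal.ofReal (A + B * m) := lintegral_unlabeledDensity_mul_le μ₀ hA hB hs
      _ ≤ _ := by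
          refine ENNReal.ofReal_le_ofReal (le_trans (le_of_eq ?_) (hbound _ hb))
          simp only [A, B]
          ring

/-! ### The lower bound -/

theorem HasRatioMoment.dataLaw {p : ℕ} {μ₁ μ₀ : Fin p → ℝ} {β : ℝ} (hβ : 0 ≤ β)
    {RL RU : ℝ≥0∞} (hL : HasRatioMoment (labeledLaw μ₁) (labeledLaw μ₀) β RL)
    (hU : HasRatioMoment (unlabeledLaw μ₁) (unlabeledLaw μ₀) β RU) (L n : ℕ) :
    HasRatioMoment (dataLaw μ₁ L n) (dataLaw μ₀ L n) β (RL ^ L * RU ^ n) := by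
  have h1 : HasRatioMoment (Measure.pi fun _ : Fin L => labeledLaw μ₁)
      (Measure.pi fun _ : Fin L => labeledLaw μ₀) β (RL ^ L) := by
    simpa using HasRatioMoment.pi hβ fun _ : Fin L => hL
  have h2 : HasRatioMoment (Measure.pi fun _ : Fin n => unlabeledLaw μ₁)
      (Measure.pi fun _ : Fin n => unlabeledLaw μ₀) β (RU ^ n) := by
    simpa using HasRatioMoment.pi hβ fun _ : Fin n => hU
  have : SigmaFinite (Measure.pi fun _ : Fin L => labeledLaw μ₀) := IsFiniteMeasure.toSigmaFinite _
  have : SFinite (Measure.pi fun _ : Fin L => labeledLaw μ₀) := instSFiniteOfSigmaFinite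
  exact h1.prod hβ h2

theorem exists_measure_le_inv_card {Ω ι : Type*} [MeasurableSpace Ω] (Q : Measure Ω)
    [IsProbabilityMeasure Q] {J : Finset ι} (hJ : J.Nonempty) {A : ι → Set Ω}
    (hA : ∀ j ∈ J, MeasurableSet (A j)) (hd : (J : Set ι).PairwiseDisjoint A) :
    ∃ j ∈ J, Q (A j) ≤ (J.card : ℝ≥0∞)⁻¹ := by
  by_contra! h
  have h1 : ∑ j ∈ J, (J.card : ℝ≥0∞)⁻¹ < ∑ j ∈ J, Q (A j) :=
    ENNReal.sum_lt_sum_of_nonempty hJ h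
  rw [← measure_biUnion_finset hd hA, Finset.sum_const, nsmul_eq_mul,
    ENNReal.mul_inv_cancel (by simpa using hJ.ne_empty) (ENNReal.natCast_ne_top _)] at h1
  exact absurd prob_le_one (not_le.2 h1)

theorem meanVec_insert_of_ne {p : ℕ} (lam : ℝ) (k : ℕ) (ε : Fin p → ℤˣ) (S : Finset (Fin p))
    {i j : Fin p} (hij : i ≠ j) : meanVec lam k ε (insert j S) i = meanVec lam k ε S i := by
  simp [meanVec, hij]

theorem meanVec_sq_of_mem {p : ℕ} {lam : ℝ} (hlam : 0 ≤ lam) (k : ℕ) (ε : Fin p → ℤˣ)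
    {S : Finset (Fin p)} {j : Fin p} (hj : j ∈ S) : meanVec lam k ε S j ^ 2 = lam / k := by
  rw [meanVec, if_pos hj, mul_pow, Real.sq_sqrt (by positivity)]
  rcases Int.units_eq_one_or (ε j) with h | h <;> simp [h]

theorem meanVec_of_notMem {p : ℕ} (lam : ℝ) (k : ℕ) (ε : Fin p → ℤˣ)
    {S : Finset (Fin p)} {j : Fin p} (hj : j ∉ S) : meanVec lam k ε S j = 0 := by
  rw [meanVec, if_neg hj]

theorem sum_meanVec_sq {p : ℕ} {lam : ℝ} (hlam : 0 ≤ lam) (k : ℕ) (ε : Fin p → ℤˣ)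
    (S : Finset (Fin p)) : ∑ j, meanVec lam k ε S j ^ 2 = S.card * (lam / k) := by
  rw [← Finset.sum_subset (Finset.subset_univ S) fun j _ hj => by
    rw [meanVec_of_notMem lam k ε hj]; norm_num,
    Finset.sum_congr rfl fun j hj => meanVec_sq_of_mem hlam k ε hj, Finset.sum_const,
    nsmul_eq_mul]

/-- The reference support has size `k - 1`, so it is not itself a candidate; it is nested in `p - k
+ 1` candidates that each differ from it in a single coordinate. -/
theorem le_maxErrorProb_of_forall {p L n : ℕ} {lam : ℝ} {k : ℕ} {ε : Fin p → ℤˣ}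
    {Shat : Data p L n → Finset (Fin p)} (hShat : IsSupportEstimator Shat)
    (hk : 1 ≤ k) (hkp : k ≤ p) {α : ℝ} (hα : 0 < α) {δ : ℝ} {τ R : ℝ≥0∞} (hτ : τ ≠ 0)
    (hτ' : τ ≠ ∞)
    (hR : ∀ (S : Finset (Fin p)) (j : Fin p), S.card + 1 = k → j ∉ S →
      HasRatioMoment (dataLaw (meanVec lam k ε (insert j S)) L n)
        (dataLaw (meanVec lam k ε S) L n) (1 + α) R)
    (hbound : τ * ((p - k + 1 : ℕ) : ℝ≥0∞)⁻¹ + τ ^ (-α) * R ≤ ENNReal.ofReal (1 - δ))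
    (hδ : δ ≤ 1) :
    ENNReal.ofReal δ ≤ maxErrorProb lam k ε Shat := by
  obtain ⟨S, -, hS⟩ := Finset.exists_subset_card_eq
    (s := (Finset.univ : Finset (Fin p))) (n := k - 1) (by simp; omega)
  have hSc : Sᶜ.card = p - k + 1 := by
    rw [Finset.card_compl, hS, Fintype.card_fin]; omega
  have hd : ((Sᶜ : Finset (Fin p)) : Set (Fin p)).PairwiseDisjoint
      fun j => Shat ⁻¹' {insert j S} := by
    intro i hi j hj hij
    have hi' : i ∉ S := by simpa using hi
    refine Set.disjoint_left.2 fun D h1 h2 => hij ?_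
    have h3 : insert i S = insert j S := Eq.trans (Eq.symm h1) h2
    have h4 : i ∈ insert j S := h3 ▸ Finset.mem_insert_self i S
    exact (Finset.mem_insert.1 h4).resolve_right hi'
  obtain ⟨j, hj, hQ⟩ := exists_measure_le_inv_card (dataLaw (meanVec lam k ε S) L n)
    (J := Sᶜ) (Finset.card_pos.1 (by omega)) (fun j _ => hShat (insert j S)) hd
  have hjS : j ∉ S := by simpa using hj
  have hP := (hR S j (by omega) hjS).measure_le hα hτ hτ' (hShat (insert j S))
  rw [hSc] at hQ
  have hP2 : dataLaw (meanVec lam k ε (insert j S)) L n (Shat ⁻¹' {insert j S}) ≤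
      ENNReal.ofReal (1 - δ) :=
    hP.trans (le_trans (by gcongr) hbound)
  have hmem : insert j S ∈ Finset.powersetCard k (Finset.univ : Finset (Fin p)) := by
    rw [Finset.mem_powersetCard]
    exact ⟨Finset.subset_univ _, by rw [Finset.card_insert_of_notMem hjS]; omega⟩
  refine le_trans ?_ (le_iSup₂ (f := fun S _ => dataLaw (meanVec lam k ε S) L n
    {D | Shat D ≠ S}) (insert j S) hmem)
  have hcompl : {D | Shat D ≠ insert j S} = (Shat ⁻¹' {insert j S})ᶜ := rfl
  rw [hcompl, prob_compl_eq_one_sub (hShat _)]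
  calc ENNReal.ofReal δ = 1 - ENNReal.ofReal (1 - δ) := by
        rw [← ENNReal.ofReal_one, ← ENNReal.ofReal_sub _ (by linarith), sub_sub_cancel]
    _ ≤ _ := tsub_le_tsub_left hP2 1

/-! ### Moment bound for the whole data and choice of constants -/

theorem sum_sq_meanVec_insert_sub {p : ℕ} {lam : ℝ} (hlam : 0 ≤ lam) (k : ℕ) (ε : Fin p → ℤˣ)
    {S : Finset (Fin p)} {j : Fin p} (hj : j ∉ S) :
    ∑ i, (meanVec lam k ε (insert j S) i - meanVec lam k ε S i) ^ 2 = lam / k := by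
  rw [Finset.sum_eq_single j (fun i _ hi => by rw [meanVec_insert_of_ne _ _ _ _ hi]; simp)
    (by simp), meanVec_of_notMem lam k ε hj, sub_zero,
    meanVec_sq_of_mem hlam k ε (Finset.mem_insert_self j S)]

theorem exists_hasRatioMoment_dataLaw {lam : ℝ} (hlam : 0 < lam) {c : ℝ} (hc : 0 < c)
    (hc1 : c < 1) :
    ∃ r : ℝ, 0 < r ∧ ∀ (p k L n : ℕ) (ε : Fin p → ℤˣ) (S : Finset (Fin p)) (j : Fin p),
      S.card + 1 = k → j ∉ S → lam / k < r →
      HasRatioMoment (dataLaw (meanVec lam k ε (insert j S)) L n)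
        (dataLaw (meanVec lam k ε S) L n) (1 + c) (ENNReal.ofReal (Real.exp
          ((1 + c) * c / 2 * (1 + c) ^ 2 * (L * (lam / k) + n * (min 1 lam * (lam / k)))))) := by
  obtain ⟨r, hr, h⟩ := exists_hasRatioMoment_unlabeledLaw (m := min 1 lam) hc hc1 hc
    (lt_min one_pos hlam)
  refine ⟨r, hr, fun p k L n ε S j hk hj hkr => ?_⟩
  have hk0 : (0 : ℝ) < k := by
    rw [← hk]; positivity
  have hb := meanVec_sq_of_mem hlam.le k ε (Finset.mem_insert_self j S)
  have hU := h p (meanVec lam k ε (insert j S)) (meanVec lam k ε S) j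
    (fun i hi => meanVec_insert_of_ne lam k ε S hi) (meanVec_of_notMem lam k ε hj) ?_
    (by rw [hb]; exact ⟨by positivity, hkr⟩)
  · have hL := hasRatioMoment_labeledLaw (meanVec lam k ε (insert j S)) (meanVec lam k ε S)
      (β := 1 + c) (by linarith)
    rw [sum_sq_meanVec_insert_sub hlam.le k ε hj, add_sub_cancel_left] at hL
    rw [hb] at hU
    refine (HasRatioMoment.dataLaw (by linarith) hL hU L n).mono ?_
    rw [← ENNReal.ofReal_pow (Real.exp_pos _).le, ← ENNReal.ofReal_pow (Real.exp_pos _).le,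
      ← ENNReal.ofReal_mul (by positivity), ← Real.exp_nat_mul, ← Real.exp_nat_mul,
      ← Real.exp_add]
    refine ENNReal.ofReal_le_ofReal (Real.exp_le_exp.2 ?_)
    -- The labeled part does not need the factor `(1 + c) ^ 2`; it is granted so that both parts
    -- share one constant.
    have h1 : (1 : ℝ) ≤ (1 + c) ^ 2 := by nlinarith
    have h2 : 0 ≤ (1 + c) * c / 2 * (L * (lam / k)) := by positivity
    nlinarith [mul_le_mul_of_nonneg_left h1 h2]
  · rw [sum_meanVec_sq hlam.le]
    rcases le_total 1 lam with h1 | h1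
    · exact Or.inl (le_min le_rfl h1)
    · refine Or.inr ?_
      -- The reference mean has squared norm `(k - 1) * lam / k ≤ lam`.
      rw [min_eq_right h1, mul_div_assoc', div_le_iff₀ hk0, ← hk]
      push_cast
      nlinarith

end SparseMixture

theorem mainTheorem4
    (δ : ℝ) (hδ : δ ∈ Set.Ioo (0 : ℝ) 1) (lam : ℝ) (hlam : 0 < lam)
    (p k : ℕ → ℕ) (L₀ n₀ : ℕ → ℝ)
    (hp : Tendsto p atTop atTop) (hk : Tendsto k atTop atTop)
    (hL₀ : Tendsto L₀ atTop atTop) (hn₀ : Tendsto n₀ atTop atTop)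
    (hkp : Tendsto (fun m => (k m : ℝ) / (p m : ℝ)) atTop (𝓝 0))
    (hL₀_lt : ∀ᶠ m in atTop,
      L₀ m < 2 * (1 - δ) * (k m : ℝ) / lam * Real.log ((p m : ℝ) - (k m : ℝ) + 1))
    (hn₀_lt : ∀ᶠ m in atTop,
      n₀ m < 2 * (1 - δ) * (k m : ℝ) / lam ^ 2 * Real.log ((p m : ℝ) - (k m : ℝ) + 1)
        * max 1 lam)
    (q : ℕ → ℝ) (hq : ∀ m, q m ∈ Set.Icc (0 : ℝ) 1)
    (L n : ℕ → ℕ) (hL : ∀ m, L m = ⌊q m * L₀ m⌋₊) (hn : ∀ m, n m = ⌊(1 - q m) * n₀ m⌋₊)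
    (ε : ∀ m, Fin (p m) → ℤˣ)
    (Shat : ∀ m, SparseMixture.Data (p m) (L m) (n m) → Finset (Fin (p m)))
    (hShat : ∀ m, SparseMixture.IsSupportEstimator (Shat m)) :
    ∀ᶠ m in atTop,
      ENNReal.ofReal δ ≤ SparseMixture.maxErrorProb lam (k m) (ε m) (Shat m) := by
  obtain ⟨hδ0, hδ1⟩ := hδ
  -- This `c` serves as moment exponent and as Taylor slack; the gap `2 * c` pays for taking `τ`
  -- below `M`.
  obtain ⟨c, hc0, hc1, hc⟩ : ∃ c : ℝ, 0 < c ∧ c < 1 ∧ (1 + c) ^ 3 * (1 - δ) ≤ 1 - 2 * c := by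
    refine ⟨δ / 10, by linarith, by linarith, ?_⟩
    have h1 : (1 + δ / 10) ^ 3 ≤ 1 + 7 * (δ / 10) := by nlinarith [mul_pos hδ0 hδ0]
    nlinarith [mul_le_mul_of_nonneg_right h1 (by linarith : 0 ≤ 1 - δ)]
  obtain ⟨r, hr, hmom⟩ := SparseMixture.exists_hasRatioMoment_dataLaw hlam hc0 hc1
  have hpR : Tendsto (fun m => (p m : ℝ)) atTop atTop := tendsto_natCast_atTop_atTop.comp hp
  have hkR : Tendsto (fun m => (k m : ℝ)) atTop atTop := tendsto_natCast_atTop_atTop.comp hk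
  have hkr : ∀ᶠ m in atTop, lam / (k m : ℝ) < r :=
    (hkR.const_div_atTop lam).eventually_lt_const hr
  have hhalf : ∀ᶠ m in atTop, (k m : ℝ) ≤ (p m : ℝ) / 2 := by
    filter_upwards [hkp.eventually_lt_const (by norm_num : (0 : ℝ) < 1 / 2),
      hpR.eventually_gt_atTop 0] with m h1 h2
    rw [div_lt_iff₀ h2] at h1
    linarith
  have hM : Tendsto (fun m => (p m : ℝ) - k m + 1) atTop atTop := by
    refine tendsto_atTop_mono' _ ?_ (hpR.atTop_div_const (two_pos))
    filter_upwards [hhalf] with m h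
    linarith
  have hlog : Tendsto (fun m => Real.log ((p m : ℝ) - k m + 1)) atTop atTop :=
    Real.tendsto_log_atTop.comp hM
  have hsmall : ∀ᶠ m in atTop, Real.exp (-(c * Real.log ((p m : ℝ) - k m + 1))) +
      Real.exp (-(c * c * Real.log ((p m : ℝ) - k m + 1))) ≤ 1 - δ := by
    have h : ∀ d : ℝ, 0 < d → Tendsto
        (fun m => Real.exp (-(d * Real.log ((p m : ℝ) - k m + 1)))) atTop (𝓝 0) := fun d hd =>
      Real.tendsto_exp_neg_atTop_nhds_zero.comp (hlog.const_mul_atTop hd)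
    have h2 := (h c hc0).add (h (c * c) (mul_pos hc0 hc0))
    rw [add_zero] at h2
    exact h2.eventually_le_const (by linarith)
  filter_upwards [hL₀_lt, hn₀_lt, hkr, hhalf, hsmall, hk.eventually_ge_atTop 1,
    hL₀.eventually_ge_atTop 0, hn₀.eventually_ge_atTop 0, hpR.eventually_gt_atTop 0]
    with m hLlt hnlt hkr hhalf hsmall hk1 hL0 hn0 hp0
  have hkp : k m ≤ p m := by
    have : (k m : ℝ) ≤ p m := by linarith
    exact_mod_cast this
  have hMcast : ((p m - k m + 1 : ℕ) : ℝ) = (p m : ℝ) - k m + 1 := by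
    rw [Nat.cast_add, Nat.cast_sub hkp, Nat.cast_one]
  set ℓ := Real.log ((p m : ℝ) - k m + 1) with hℓ
  have hMpos : 0 < (p m : ℝ) - k m + 1 := by linarith
  have hk0 : (0 : ℝ) < k m := by exact_mod_cast hk1
  obtain ⟨hq0, hq1⟩ := hq m
  have hLle : (L m : ℝ) * (lam / k m) ≤ q m * (2 * (1 - δ) * ℓ) := by
    have h1 : (L m : ℝ) ≤ q m * L₀ m := by
      rw [hL m]; exact Nat.floor_le (mul_nonneg hq0 hL0)
    calc (L m : ℝ) * (lam / k m) ≤ q m * (2 * (1 - δ) * k m / lam * ℓ) * (lam / k m) := by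
          refine mul_le_mul_of_nonneg_right (h1.trans ?_) (by positivity)
          exact mul_le_mul_of_nonneg_left hLlt.le hq0
      _ = q m * (2 * (1 - δ) * ℓ) := by field_simp
  have hnle : (n m : ℝ) * (min 1 lam * (lam / k m)) ≤ (1 - q m) * (2 * (1 - δ) * ℓ) := by
    have h1 : (n m : ℝ) ≤ (1 - q m) * n₀ m := by
      rw [hn m]; exact Nat.floor_le (mul_nonneg (by linarith) hn0)
    -- The factor `max 1 lam` in the sample size exactly offsets the reduced information `min 1 lam`
    -- of an unlabeled sample.
    have hmm : min 1 lam * max 1 lam = lam := by rw [min_mul_max, one_mul]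
    have hm0 : 0 < min 1 lam := lt_min one_pos hlam
    calc (n m : ℝ) * (min 1 lam * (lam / k m))
        ≤ (1 - q m) * (2 * (1 - δ) * k m / lam ^ 2 * ℓ * max 1 lam) *
          (min 1 lam * (lam / k m)) := by
          refine mul_le_mul_of_nonneg_right (h1.trans ?_) (by positivity)
          exact mul_le_mul_of_nonneg_left hnlt.le (by linarith)
      _ = (1 - q m) * (2 * (1 - δ) * ℓ) * ((min 1 lam * max 1 lam) / lam) := by field_simp
      _ = (1 - q m) * (2 * (1 - δ) * ℓ) := by rw [hmm, div_self hlam.ne', mul_one]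
  have hℓ0 : 0 ≤ ℓ := Real.log_nonneg (by linarith)
  -- With `M = exp ℓ` and `τ = M ^ (1 - c)`, the first term is `M ^ (-c)`. The weights `q` and `1 -
  -- q` add up to one, so `R ≤ M ^ (c * (1 - 2 * c))` and the second term is at most `M ^ (-c²)`.
  refine SparseMixture.le_maxErrorProb_of_forall (hShat m) hk1 hkp hc0
    (τ := ENNReal.ofReal (Real.exp ((1 - c) * ℓ))) (by simp [Real.exp_pos]) ENNReal.ofReal_ne_top
    (fun S j hS hj => hmom (p m) (k m) (L m) (n m) (ε m) S j hS hj hkr) ?_ hδ1.le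
  have hcard : ((p m - k m + 1 : ℕ) : ℝ≥0∞)⁻¹ = ENNReal.ofReal (Real.exp (-ℓ)) := by
    rw [Real.exp_neg, hℓ, Real.exp_log hMpos, ENNReal.ofReal_inv_of_pos hMpos, ← hMcast,
      ENNReal.ofReal_natCast]
  rw [hcard, ENNReal.ofReal_rpow_of_pos (Real.exp_pos _), ← Real.exp_mul,
    ← ENNReal.ofReal_mul (Real.exp_pos _).le, ← ENNReal.ofReal_mul (Real.exp_pos _).le,
    ← Real.exp_add, ← Real.exp_add, ← ENNReal.ofReal_add (Real.exp_pos _).le (Real.exp_pos _).le]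
  refine ENNReal.ofReal_le_ofReal (le_trans (add_le_add ?_ ?_) hsmall)
  · exact Real.exp_le_exp.2 (le_of_eq (by ring))
  · refine Real.exp_le_exp.2 ?_
    have h1 := mul_le_mul_of_nonneg_left (add_le_add hLle hnle)
      (by positivity : 0 ≤ (1 + c) * c / 2 * (1 + c) ^ 2)
    have h2 := mul_le_mul_of_nonneg_left hc (mul_nonneg hc0.le hℓ0)
    nlinarith
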